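/- Let $\mathcal H$ be an infinite-dimensional real Hilbert space with an orthonormal basis $\{e_j\}_{j=0}^\infty$, let $a_n$ ($n\ge 1$) be nonzero real numbers, and put $a_0=0$ (so that the term with $e_{-1}$ below is absent). The Larson–Wogen system $\mathfrak F_{LW}=\{f_n\}_{n=0}^\infty$ and the system $\mathfrak F_{LW}^*=\{f_n^*\}_{n=0}^\infty$ are defined, for $j\ge 0$, by $$f_{2j}=e_{2j},\qquad f_{2j+1}=-a_{2j+1}e_{2j}+e_{2j+1}+a_{2j+2}e_{2j+2},$$ $$f^*_{2j}=-a_{2j}e_{2j-1}+e_{2j}+a_{2j+1}e_{2j+1},\qquad f^*_{2j+1}=e_{2j+1}.$$ A sequence in $\mathcal H$ is *complete* if its closed linear span is $\mathcal H$, and *minimal* if none of its elements lies in the closed linear span of the others; two sequences are *biorthogonal* if $\langle f_m,f^*_n\rangle=\delta_{mn}$. A complete minimal sequence has a unique biorthogonal sequence, and it is an *M-basis* if that sequence is complete as well. An M-basis $\{f_n\}$ with biorthogonal sequence $\{f_n^*\}$ is a *strong M-basis* if every $x\in\mathcal H$ lies in the closed linear span of $\{\langle x,f_n^*\rangle f_n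 : n\ge 0\}$. Let $\mathcal A=\{T\in B(\mathcal H): \text{for every } n\ge 0 \text{ there is } \lambda_n\in\mathbb R \text{ with } Tf_n=\lambda_nf_n\}$, and let $R_1(\mathcal A)$ be the (not necessarily unital) algebra generated by the rank one operators of $\mathcal A$. For $k\ge 1$ the sequence $\{f_n\}$ is *$k$ point dense* if for all $x_1,\dots,x_k\in\mathcal H$ and $\varepsilon>0$ there is $T\in R_1(\mathcal A)$ with $\|Tx_s-x_s\|<\varepsilon$ for $1\le s\le k$. **Theorem.** The sequences $\mathfrak F_{LW}$ and $\mathfrak F_{LW}^*$ are biorthogonal and both are complete in $\mathcal H$; in particular $\mathfrak F_{LW}$ is an M-basis. Moreover: 1. $\mathfrak F_{LW}$ is one point dense if and only if the sequence $$\mu_n=\frac{a_{n-1}a_{n-3}\cdots}{a_na_{n-2}\cdots}\qquad(n\ge 1)$$ does not belong to $\ell^2$, where both products run over the positive indices only and an empty product is $1$ (so $\mu_1=1/a_1$, $\mu_2=a_1/a_2$, $\mu_3=a_2/(a_3a_1)$). Likewise, $\mathfrak F_{LW}$ is a strong M-basis if and only if $\{\mu_n\}_{n=1}^\infty\notin\ell^2$.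 2. For every integer $k>1$, $\mathfrak F_{LW}$ is $k$ point dense if and only if the sequence $\{1/a_n\}_{n=1}^\infty$ does not belong to $\ell^1$. -/

import Mathlib

open scoped InnerProductSpace

noncomputable section

/-- The systems `f` and `g` are biorthogonal: `⟪f m, g n⟫ = δ_{mn}`. -/
def IsBiorthogonal {H : Type*} [NormedAddCommGroup H] [InnerProductSpace ℝ H]
    (f g : ℕ → H) : Prop :=
  ∀ m n : ℕ, ⟪f m, g n⟫_ℝ = if m = n then 1 else 0

/-- The closed linear span of the system is the whole space. -/
def IsCompleteSystem {H : Type*} [NormedAddCommGroup H] [InnerProductSpace ℝ H]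
    (f : ℕ → H) : Prop :=
  (Submodule.span ℝ (Set.range f)).topologicalClosure = ⊤

/-- No element of the system lies in the closed linear span of the others. -/
def IsMinimalSystem {H : Type*} [NormedAddCommGroup H] [InnerProductSpace ℝ H]
    (f : ℕ → H) : Prop :=
  ∀ n : ℕ, f n ∉ (Submodule.span ℝ (f '' {m | m ≠ n})).topologicalClosure

/-- An M-basis: a complete minimal system whose biorthogonal system is complete as well. -/
def IsMBasis {H : Type*} [NormedAddCommGroup H] [InnerProductSpace ℝ H]
    (f : ℕ → H) : Prop :=
  IsMinimalSystem f ∧ IsCompleteSystem f ∧ ∃ g : ℕ → H, IsBiorthogonal f g ∧ IsCompleteSystem g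

/-- A strong M-basis: an M-basis such that every `x` is in the closed linear span of
the vectors `⟪x, g n⟫ f n`, where `g` is the biorthogonal system of `f` (it is unique,
since `f` is complete). -/
def IsStrongMBasis {H : Type*} [NormedAddCommGroup H] [InnerProductSpace ℝ H]
    (f : ℕ → H) : Prop :=
  IsMBasis f ∧ ∀ g : ℕ → H, IsBiorthogonal f g → ∀ x : H,
    x ∈ (Submodule.span ℝ (Set.range fun n : ℕ => ⟪x, g n⟫_ℝ • f n)).topologicalClosure

/-- The algebra `𝒜` of bounded operators for which every `f n` is an eigenvector. -/
def diagAlgebra {H : Type*} [NormedAddCommGroup H] [InnerProductSpace ℝ H]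
    (f : ℕ → H) : Subalgebra ℝ (H →L[ℝ] H) where
  carrier := {T | ∀ n : ℕ, ∃ c : ℝ, T (f n) = c • f n}
  mul_mem' := by
    intro S T hS hT n
    obtain ⟨c, hc⟩ := hS n
    obtain ⟨d, hd⟩ := hT n
    exact ⟨d * c, by simp [hc, hd, mul_smul]⟩
  add_mem' := by
    intro S T hS hT n
    obtain ⟨c, hc⟩ := hS n
    obtain ⟨d, hd⟩ := hT n
    exact ⟨c + d, by simp [hc, hd, add_smul]⟩
  algebraMap_mem' := by
    intro r n
    exact ⟨r, by simp [Algebra.algebraMap_eq_smul_one]⟩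

/-- The (not necessarily unital) algebra `R₁(𝒜)` generated by the rank one operators of `𝒜`. -/
def rankOneAlgebra {H : Type*} [NormedAddCommGroup H] [InnerProductSpace ℝ H]
    (f : ℕ → H) : NonUnitalSubalgebra ℝ (H →L[ℝ] H) :=
  NonUnitalAlgebra.adjoin ℝ
    {T : H →L[ℝ] H | T ∈ diagAlgebra f ∧ Module.finrank ℝ (LinearMap.range T.toLinearMap) = 1}

/-- `k` point density: any `k` vectors can be approximated simultaneously by their images under
a single operator of `R₁(𝒜)`. (The operator has to be taken in `R₁(𝒜)`: since `𝒜` contains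
the identity, the condition with `𝒜` in its place would hold for every system.) -/
def IsKPointDense {H : Type*} [NormedAddCommGroup H] [InnerProductSpace ℝ H]
    (f : ℕ → H) (k : ℕ) : Prop :=
  ∀ (x : Fin k → H) (ε : ℝ), 0 < ε → ∃ T ∈ rankOneAlgebra f, ∀ s : Fin k, ‖T (x s) - x s‖ < ε

/-- The Larson–Wogen system: `f n = e n` for even `n`, and
`f n = -a n e (n-1) + e n + a (n+1) e (n+1)` for odd `n`. -/
def lwSystem {H : Type*} [NormedAddCommGroup H] [InnerProductSpace ℝ H]
    (e : HilbertBasis ℕ ℝ H) (a : ℕ → ℝ) (n : ℕ) : H :=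
  if Even n then e n else -(a n • e (n - 1)) + e n + a (n + 1) • e (n + 1)

/-- The dual Larson–Wogen system: `f* n = e n` for odd `n`, and
`f* n = -a n e (n-1) + e n + a (n+1) e (n+1)` for even `n`, where the first term is
absent for `n = 0` (this is the convention `a 0 = 0`). -/
def lwDual {H : Type*} [NormedAddCommGroup H] [InnerProductSpace ℝ H]
    (e : HilbertBasis ℕ ℝ H) (a : ℕ → ℝ) (n : ℕ) : H :=
  if Even n then
    (if n = 0 then 0 else -(a n • e (n - 1))) + e n + a (n + 1) • e (n + 1)
  else e n

/-- The product `a n * a (n-2) * a (n-4) * ⋯` over the positive indices of the parity of `n`. -/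
def stepProd (a : ℕ → ℝ) : ℕ → ℝ
  | 0 => 1
  | 1 => a 1
  | n + 2 => a (n + 2) * stepProd a n

/-- `μ n = (a (n-1) * a (n-3) * ⋯) / (a n * a (n-2) * ⋯)`, for `n ≥ 1`. -/
def lwMu (a : ℕ → ℝ) (n : ℕ) : ℝ :=
  stepProd a (n - 1) / stepProd a n

end

/-! ### Duality: density of `R₁(𝒜)` as a trace condition. -/

section Biorthogonal

variable {H : Type*} [NormedAddCommGroup H] [InnerProductSpace ℝ H] {f g : ℕ → H}

theorem IsCompleteSystem.dense_span (hf : IsCompleteSystem f) :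
    Dense (Submodule.span ℝ (Set.range f) : Set H) :=
  Submodule.dense_iff_topologicalClosure_eq_top.2 hf

theorem IsBiorthogonal.isMinimalSystem (h : IsBiorthogonal f g) : IsMinimalSystem f := by
  intro n hn
  have hle : (Submodule.span ℝ (f '' {m | m ≠ n})).topologicalClosure ≤
      LinearMap.ker (innerSL ℝ (g n)).toLinearMap := by
    refine Submodule.topologicalClosure_minimal _ (Submodule.span_le.2 ?_)
      (ContinuousLinearMap.isClosed_ker (innerSL ℝ (g n)))
    rintro _ ⟨m, hm, rfl⟩
    have := h m n
    rw [if_neg hm, real_inner_comm] at this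
    simpa using this
  have h0 : ⟪g n, f n⟫_ℝ = 0 := by simpa using hle hn
  have h1 := h n n
  rw [if_pos rfl, real_inner_comm, h0] at h1
  exact zero_ne_one h1

theorem IsBiorthogonal.unique (hf : IsCompleteSystem f) (h : IsBiorthogonal f g) {g' : ℕ → H}
    (h' : IsBiorthogonal f g') : g' = g := by
  funext n
  have : innerSL ℝ (g' n) = innerSL ℝ (g n) := by
    refine ContinuousLinearMap.ext_on hf.dense_span ?_
    rintro _ ⟨m, rfl⟩
    simp only [innerSL_apply_apply]
    rw [real_inner_comm, h' m n, real_inner_comm, h m n]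
  refine ext_inner_right ℝ fun v => ?_
  simpa using congrArg (fun T => T v) this

/-- The coordinate projection `x ↦ ⟪x, g n⟫ f n`. -/
noncomputable def coordProj (f g : ℕ → H) (n : ℕ) : H →L[ℝ] H :=
  (innerSL ℝ (g n)).smulRight (f n)

theorem coordProj_apply (n : ℕ) (x : H) : coordProj f g n x = ⟪x, g n⟫_ℝ • f n := by
  simp [coordProj, real_inner_comm]

theorem coordProj_mul (h : IsBiorthogonal f g) (m n : ℕ) :
    coordProj f g m * coordProj f g n = (if n = m then (1 : ℝ) else 0) • coordProj f g n := by
  ext x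
  simp only [mul_apply_eq_comp, coordProj_apply, inner_smul_left, h n m,
    smul_apply]
  split_ifs with hnm <;> simp [hnm]

theorem IsBiorthogonal.ne_zero (h : IsBiorthogonal f g) (n : ℕ) : f n ≠ 0 := by
  intro h0
  simpa [h0] using h n n

theorem coordProj_mem_rankOneAlgebra (h : IsBiorthogonal f g) (n : ℕ) :
    coordProj f g n ∈ rankOneAlgebra f := by
  refine NonUnitalAlgebra.subset_adjoin ℝ ⟨fun m => ⟨if m = n then 1 else 0, ?_⟩, ?_⟩
  · rw [coordProj_apply, h m n]
    split_ifs with hmn <;> simp [hmn]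
  · have : LinearMap.range (coordProj f g n).toLinearMap = Submodule.span ℝ {f n} := by
      apply le_antisymm
      · rintro _ ⟨x, rfl⟩
        exact Submodule.mem_span_singleton.2 ⟨_, (coordProj_apply n x).symm⟩
      · rw [Submodule.span_singleton_le_iff_mem]
        refine ⟨f n, ?_⟩
        have := coordProj_apply (f := f) (g := g) n (f n)
        rw [h n n, if_pos rfl, one_smul] at this
        exact this
    rw [this]
    exact finrank_span_singleton (h.ne_zero n)

/-- Two nonzero eigenvalues would put two independent `f n` into a one-dimensional range. -/
theorem mem_span_coordProj_of_finrank_range_eq_one (hf : IsCompleteSystem f)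
    (h : IsBiorthogonal f g) {T : H →L[ℝ] H} (hT : T ∈ diagAlgebra f)
    (hrank : Module.finrank ℝ (LinearMap.range T.toLinearMap) = 1) :
    T ∈ Submodule.span ℝ (Set.range (coordProj f g)) := by
  choose c hc using hT
  by_cases hz : ∀ n, c n = 0
  · have : T = 0 := by
      refine ContinuousLinearMap.ext_on hf.dense_span ?_
      rintro _ ⟨m, rfl⟩
      simp [hc, hz]
    rw [this]
    exact zero_mem _
  obtain ⟨n, hn⟩ := not_forall.1 hz
  have hne : (⟨T (f n), ⟨f n, rfl⟩⟩ : LinearMap.range T.toLinearMap) ≠ 0 := by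
    intro h0
    have := congrArg Subtype.val h0
    simp only [hc, ZeroMemClass.coe_zero, smul_eq_zero] at this
    exact this.elim hn (h.ne_zero n)
  have hall := (finrank_eq_one_iff_of_nonzero' _ hne).1 hrank
  have hoff : ∀ m, m ≠ n → c m = 0 := by
    intro m hm
    obtain ⟨t, ht⟩ := hall ⟨T (f m), ⟨f m, rfl⟩⟩
    have ht' : t • T (f n) = T (f m) := congrArg Subtype.val ht
    rw [hc, hc] at ht'
    have := congrArg (fun v => ⟪v, g m⟫_ℝ) ht'
    simpa [inner_smul_left, h n m, h m m, hm.symm] using this.symm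
  have : T = c n • coordProj f g n := by
    refine ContinuousLinearMap.ext_on hf.dense_span ?_
    rintro _ ⟨m, rfl⟩
    rw [hc, smul_apply, coordProj_apply, h m n]
    split_ifs with hmn
    · simp [hmn]
    · simp [hoff m hmn]
  rw [this]
  exact Submodule.smul_mem _ _ (Submodule.subset_span ⟨n, rfl⟩)

theorem mem_rankOneAlgebra_iff (hf : IsCompleteSystem f) (h : IsBiorthogonal f g)
    {T : H →L[ℝ] H} :
    T ∈ rankOneAlgebra f ↔ T ∈ Submodule.span ℝ (Set.range (coordProj f g)) := by
  constructor
  · intro hT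
    induction hT using NonUnitalAlgebra.adjoin_induction with
    | mem T hT => exact mem_span_coordProj_of_finrank_range_eq_one hf h hT.1 hT.2
    | add _ _ _ _ hS hT => exact add_mem hS hT
    | zero => exact zero_mem _
    | smul r _ _ hT => exact Submodule.smul_mem _ r hT
    | mul S T _ _ hS hT =>
      refine Submodule.span_induction ?_ (by simp) (fun _ _ _ _ h₁ h₂ => ?_)
        (fun r _ _ h₁ => ?_) hS
      · rintro _ ⟨m, rfl⟩
        refine Submodule.span_induction ?_ (by simp) (fun _ _ _ _ h₁ h₂ => ?_)
          (fun r _ _ h₁ => ?_) hT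
        · rintro _ ⟨n, rfl⟩
          rw [coordProj_mul h]
          exact Submodule.smul_mem _ _ (Submodule.subset_span ⟨n, rfl⟩)
        · rw [mul_add]; exact add_mem h₁ h₂
        · rw [mul_smul_comm]; exact Submodule.smul_mem _ r h₁
      · rw [add_mul]; exact add_mem h₁ h₂
      · rw [smul_mul_assoc]; exact Submodule.smul_mem _ r h₁
  · intro hT
    refine Submodule.span_induction ?_ (zero_mem _) (fun _ _ _ _ h₁ h₂ => add_mem h₁ h₂)
      (fun r _ _ h₁ => SMulMemClass.smul_mem r h₁) hT
    rintro _ ⟨n, rfl⟩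
    exact coordProj_mem_rankOneAlgebra h n

/-- The dual form of `k` point density: a rank `k` form `∑ s, x s ⊗ y s` that vanishes on all the
coordinate projections vanishes on the identity. -/
def AnnihilatorTraceZero (f g : ℕ → H) (k : ℕ) : Prop :=
  ∀ x y : Fin k → H, (∀ n, ∑ s, ⟪x s, g n⟫_ℝ * ⟪f n, y s⟫_ℝ = 0) → ∑ s, ⟪x s, y s⟫_ℝ = 0

theorem isKPointDense_iff [CompleteSpace H] (hf : IsCompleteSystem f) (h : IsBiorthogonal f g)
    (k : ℕ) : IsKPointDense f k ↔ AnnihilatorTraceZero f g k := by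
  constructor
  · intro hd x y hxy
    have hT0 : ∀ T ∈ rankOneAlgebra f, ∑ s, ⟪T (x s), y s⟫_ℝ = 0 := by
      intro T hT
      refine Submodule.span_induction ?_ (by simp) (fun S T _ _ h₁ h₂ => ?_)
        (fun r S _ h₁ => ?_) ((mem_rankOneAlgebra_iff hf h).1 hT)
      · rintro _ ⟨n, rfl⟩
        simpa [coordProj_apply, inner_smul_left] using hxy n
      · simp [inner_add_left, Finset.sum_add_distrib, h₁, h₂]
      · simp [inner_smul_left, ← Finset.mul_sum, h₁]
    by_contra hne
    set C := ∑ s, ‖y s‖ with hC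
    have hC0 : 0 ≤ C := Finset.sum_nonneg fun _ _ => norm_nonneg _
    set S := ∑ s, ⟪x s, y s⟫_ℝ with hS
    have hpos : 0 < |S| := abs_pos.2 hne
    -- With this tolerance the error in the trace is at most `|S| * C / (C + 1) < |S|`.
    obtain ⟨T, hT, hclose⟩ := hd x (|S| / (C + 1)) (by positivity)
    have hSC : |S| ≤ |S| / (C + 1) * C := by
      have : S = -∑ s, ⟪T (x s) - x s, y s⟫_ℝ := by
        simp [inner_sub_left, hT0 T hT, hS]
      calc |S| = |∑ s, ⟪T (x s) - x s, y s⟫_ℝ| := by rw [this, abs_neg]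
        _ ≤ ∑ s, |⟪T (x s) - x s, y s⟫_ℝ| := Finset.abs_sum_le_sum_abs _ _
        _ ≤ ∑ s, |S| / (C + 1) * ‖y s‖ := by
          refine Finset.sum_le_sum fun s _ => (abs_real_inner_le_norm _ _).trans ?_
          exact mul_le_mul_of_nonneg_right (hclose s).le (norm_nonneg _)
        _ = |S| / (C + 1) * C := by rw [Finset.mul_sum]
    rw [div_mul_eq_mul_div, le_div_iff₀ (by positivity)] at hSC
    nlinarith
  · intro hd x ε hε
    -- Evaluation at the tuple `x`, with values in a Hilbert space, so that closure is the double
    -- orthogonal complement.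
    let Φ : (H →L[ℝ] H) →ₗ[ℝ] PiLp 2 (fun _ : Fin k => H) :=
      { toFun := fun T => WithLp.toLp 2 fun s => T (x s)
        map_add' := fun _ _ => rfl
        map_smul' := fun _ _ => rfl }
    have hΦ : ∀ T s, Φ T s = T (x s) := fun _ _ => rfl
    let V := (Submodule.span ℝ (Set.range (coordProj f g))).map Φ
    have hmem : Φ 1 ∈ V.topologicalClosure := by
      rw [← Submodule.orthogonal_orthogonal_eq_closure, Submodule.mem_orthogonal]
      intro y hy
      rw [real_inner_comm, PiLp.inner_apply]
      refine hd x (fun s => y s) fun n => ?_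
      have := (Submodule.mem_orthogonal _ _).1 hy (Φ (coordProj f g n))
        (Submodule.mem_map_of_mem (Submodule.subset_span ⟨n, rfl⟩))
      rw [PiLp.inner_apply] at this
      simpa [hΦ, coordProj_apply, inner_smul_left] using this
    obtain ⟨v, hv, hdist⟩ := Metric.mem_closure_iff.1 hmem ε hε
    obtain ⟨T, hT, rfl⟩ := hv
    refine ⟨T, (mem_rankOneAlgebra_iff hf h).2 hT, fun s => ?_⟩
    rw [dist_comm, dist_eq_norm, ← map_sub] at hdist
    exact (PiLp.norm_apply_le (Φ (T - 1)) s).trans_lt hdist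

theorem isStrongMBasis_iff [CompleteSpace H] (hf : IsCompleteSystem f) (hg : IsCompleteSystem g)
    (h : IsBiorthogonal f g) : IsStrongMBasis f ↔ AnnihilatorTraceZero f g 1 := by
  have hM : IsMBasis f := ⟨h.isMinimalSystem, hf, g, h, hg⟩
  have key : IsStrongMBasis f ↔ ∀ x : H,
      x ∈ (Submodule.span ℝ (Set.range fun n : ℕ => ⟪x, g n⟫_ℝ • f n)).topologicalClosure := by
    refine ⟨fun hs => hs.2 g h, fun hs => ⟨hM, fun g' hg' => ?_⟩⟩
    rwa [h.unique hf hg']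
  rw [key]
  constructor
  · intro hs x y hxy
    have hle : (Submodule.span ℝ
        (Set.range fun n : ℕ => ⟪x 0, g n⟫_ℝ • f n)).topologicalClosure ≤
        LinearMap.ker (innerSL ℝ (y 0)).toLinearMap := by
      refine Submodule.topologicalClosure_minimal _ (Submodule.span_le.2 ?_)
        (ContinuousLinearMap.isClosed_ker (innerSL ℝ (y 0)))
      rintro _ ⟨n, rfl⟩
      simpa [inner_smul_right, real_inner_comm] using hxy n
    simpa [real_inner_comm] using hle (hs (x 0))
  · intro hd x
    rw [← Submodule.orthogonal_orthogonal_eq_closure, Submodule.mem_orthogonal]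
    intro y hy
    have := hd (fun _ => x) (fun _ => y) fun n => by
      have := (Submodule.mem_orthogonal _ _).1 hy _ (Submodule.subset_span ⟨n, rfl⟩)
      simpa [inner_smul_left] using this
    simpa [real_inner_comm] using this

end Biorthogonal

/-! ### Real sequences: `μ`, the flux and summability. -/

section Sequences

open Filter Topology

theorem stepProd_ne_zero {a : ℕ → ℝ} (ha : ∀ n : ℕ, 0 < n → a n ≠ 0) :
    ∀ n, stepProd a n ≠ 0
  | 0 => one_ne_zero
  | 1 => ha 1 one_pos
  | n + 2 => mul_ne_zero (ha _ (by omega)) (stepProd_ne_zero ha n)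

theorem lwMu_ne_zero {a : ℕ → ℝ} (ha : ∀ n : ℕ, 0 < n → a n ≠ 0) (n : ℕ) : lwMu a n ≠ 0 :=
  div_ne_zero (stepProd_ne_zero ha _) (stepProd_ne_zero ha _)

/-- Makes the flux of `μ` identically `1` from index `1` on; truncated subtraction gives `lwMu a 0 =
1`, which the case `n = 0` needs. -/
theorem lwMu_mul_lwMu_succ {a : ℕ → ℝ} (ha : ∀ n : ℕ, 0 < n → a n ≠ 0) (n : ℕ) :
    lwMu a n * lwMu a (n + 1) = 1 / a (n + 1) := by
  rcases n with _ | n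
  · simp [lwMu, stepProd]
  · have h1 := stepProd_ne_zero ha n
    have h2 := stepProd_ne_zero ha (n + 1)
    have h3 := ha (n + 2) (by omega)
    simp only [lwMu, Nat.add_sub_cancel, stepProd]
    field_simp

theorem memℓp_two_iff {u : ℕ → ℝ} : Memℓp u 2 ↔ Summable fun n => u n ^ 2 := by
  rw [memℓp_gen_iff (by norm_num)]
  simp

theorem memℓp_one_iff {u : ℕ → ℝ} : Memℓp u 1 ↔ Summable fun n => |u n| := by
  rw [memℓp_gen_iff (by norm_num)]
  simp

theorem Summable.mul_of_sq {u v : ℕ → ℝ} (hu : Summable fun n => u n ^ 2)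
    (hv : Summable fun n => v n ^ 2) : Summable fun n => |u n * v n| := by
  refine Summable.of_nonneg_of_le (fun _ => abs_nonneg _) (fun n => ?_) (hu.add hv)
  rw [abs_mul]
  nlinarith [sq_nonneg (|u n| - |v n|), sq_abs (u n), sq_abs (v n), sq_nonneg (u n),
    sq_nonneg (v n)]

/-- The flux `a n z (n-1) z n` of a sequence `z`, equal to `0` at `n = 0`. -/
def lwFlux (a z : ℕ → ℝ) : ℕ → ℝ
  | 0 => 0
  | n + 1 => a (n + 1) * (z n * z (n + 1))

/-- A positive sequence with `r n ≤ (1 + d n) r (n + 2)` and `d` summable is bounded away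
from zero. -/
theorem exists_pos_le_of_le_one_add_mul {r d : ℕ → ℝ} (hr : ∀ n, 0 < r n) (hd0 : ∀ n, 0 ≤ d n)
    (hd : Summable d) (h : ∀ n, r n ≤ (1 + d n) * r (n + 2)) : ∃ c > 0, ∀ n, c ≤ r n := by
  -- `r n * E n` is nondecreasing along each parity class, and `E` is bounded.
  set E : ℕ → ℝ := fun n => Real.exp (∑ i ∈ Finset.range n, d i) with hE
  have hE0 : ∀ n, 0 < E n := fun n => Real.exp_pos _
  have step : ∀ n, r n * E n ≤ r (n + 2) * E (n + 2) := by
    intro n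
    have h1 : (1 + d n) * E n ≤ E (n + 2) := by
      have h2 : E (n + 2) = Real.exp (d (n + 1)) * (Real.exp (d n) * E n) := by
        simp only [hE, Finset.sum_range_succ, Real.exp_add]
        ring
      have h3 : 1 + d n ≤ Real.exp (d n) := by linarith [Real.add_one_le_exp (d n)]
      have h4 : 1 ≤ Real.exp (d (n + 1)) := Real.one_le_exp (hd0 _)
      rw [h2]
      calc (1 + d n) * E n ≤ Real.exp (d n) * E n := mul_le_mul_of_nonneg_right h3 (hE0 n).le
        _ ≤ _ := le_mul_of_one_le_left (mul_pos (Real.exp_pos _) (hE0 n)).le h4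
    calc r n * E n ≤ (1 + d n) * r (n + 2) * E n := mul_le_mul_of_nonneg_right (h n) (hE0 n).le
      _ = r (n + 2) * ((1 + d n) * E n) := by ring
      _ ≤ _ := mul_le_mul_of_nonneg_left h1 (hr _).le
  set m := min (r 0 * E 0) (r 1 * E 1) with hm
  have hm0 : 0 < m := lt_min (mul_pos (hr 0) (hE0 0)) (mul_pos (hr 1) (hE0 1))
  have lower : ∀ n, m ≤ r n * E n ∧ m ≤ r (n + 1) * E (n + 1) := by
    intro n
    induction n with
    | zero => exact ⟨min_le_left _ _, min_le_right _ _⟩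
    | succ n ih => exact ⟨ih.2, ih.1.trans (step n)⟩
  refine ⟨m / Real.exp (∑' i, d i), by positivity, fun n => ?_⟩
  rw [div_le_iff₀ (Real.exp_pos _)]
  refine (lower n).1.trans (mul_le_mul_of_nonneg_left ?_ (hr n).le)
  exact Real.exp_le_exp.2 (hd.sum_le_tsum _ fun i _ => hd0 i)

theorem summable_lwMu_sq {a : ℕ → ℝ} (ha : ∀ n : ℕ, 0 < n → a n ≠ 0) {z w : ℕ → ℝ} {L : ℝ}
    (hz : Summable fun n => z n ^ 2) (hw : Summable fun n => w n ^ 2)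
    (h : ∀ n, z n * w n = lwFlux a z n - lwFlux a z (n + 1))
    (hL : Tendsto (lwFlux a z) atTop (𝓝 L)) (hL0 : L ≠ 0) :
    Summable fun n => lwMu a n ^ 2 := by
  set β := lwFlux a z with hβ
  set m := |L| / 2 with hm
  have hm0 : 0 < m := by positivity
  obtain ⟨N, hN⟩ := eventually_atTop.1
    (hL.abs.eventually (lt_mem_nhds (show m < |L| by linarith [abs_pos.2 hL0])))
  -- Since `|β (n + 1)| = r n * r (n + 1)`, comparing consecutive fluxes cancels `r (n + 1)` and
  -- relates `r n` to `r (n + 2)`.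
  set r : ℕ → ℝ := fun n => |z n / lwMu a n| with hr
  have hrr : ∀ n, |β (n + 1)| = r n * r (n + 1) := by
    intro n
    have h1 := lwMu_mul_lwMu_succ ha n
    simp only [hr, hβ, lwFlux]
    rw [← abs_mul, div_mul_div_comm, h1]
    congr 1
    have := ha (n + 1) n.succ_pos
    field_simp
  set d : ℕ → ℝ := fun n => |z n * w n| / m with hd
  have hds : Summable d := (hz.mul_of_sq hw).div_const m
  have hd0 : ∀ n, 0 ≤ d n := fun n => by positivity
  have hrpos : ∀ n, N ≤ n → 0 < r n := by
    intro n hn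
    have h1 : 0 < r n * r (n + 1) := by
      rw [← hrr]; exact hm0.trans (hN (n + 1) (by omega))
    exact lt_of_le_of_ne (abs_nonneg _) fun h0 => by
      rw [← h0, zero_mul] at h1
      exact lt_irrefl _ h1
  have hstep : ∀ n, N ≤ n → r n ≤ (1 + d (n + 1)) * r (n + 2) := by
    intro n hn
    have h1 : |β (n + 1)| ≤ |β (n + 2)| * (1 + d (n + 1)) := by
      have h2 : |β (n + 1)| ≤ |β (n + 2)| + |z (n + 1) * w (n + 1)| := by
        rw [h (n + 1)]
        have := abs_add_le (β (n + 2)) (β (n + 1) - β (n + 2))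
        simpa using this
      have h3 : |z (n + 1) * w (n + 1)| = m * d (n + 1) := by
        simp only [hd]; field_simp
      have h4 : m * d (n + 1) ≤ |β (n + 2)| * d (n + 1) :=
        mul_le_mul_of_nonneg_right (hN (n + 2) (by omega)).le (hd0 _)
      linarith
    rw [hrr n, hrr (n + 1)] at h1
    have h5 := hrpos (n + 1) (by omega)
    refine le_of_mul_le_mul_right ?_ h5
    calc r n * r (n + 1) ≤ _ := h1
      _ = _ := by ring
  obtain ⟨c, hc, hcr⟩ := exists_pos_le_of_le_one_add_mul (r := fun n => r (n + N))
    (d := fun n => d (n + N + 1)) (fun n => hrpos _ (by omega)) (fun n => hd0 _)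
    ((summable_nat_add_iff (N + 1)).2 hds) (fun n => by
      have := hstep (n + N) (by omega)
      rwa [show n + N + 2 = n + 2 + N by ring] at this)
  rw [← summable_nat_add_iff N]
  refine Summable.of_nonneg_of_le (fun _ => sq_nonneg _) (fun n => ?_)
    (((summable_nat_add_iff N).2 hz).div_const (c ^ 2))
  rw [le_div_iff₀ (by positivity)]
  have h1 : c ≤ |z (n + N) / lwMu a (n + N)| := hcr n
  rw [abs_div, le_div_iff₀ (abs_pos.2 (lwMu_ne_zero ha _))] at h1
  rw [← sq_abs (z _), ← sq_abs (lwMu _ _), ← mul_pow]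
  exact pow_le_pow_left₀ (by positivity) (by linarith) 2

theorem summable_inv_of_tendsto_flux {a : ℕ → ℝ} (ha : ∀ n : ℕ, 0 < n → a n ≠ 0) {k : ℕ}
    {z : Fin k → ℕ → ℝ} {L : ℝ} (hz : ∀ s, Summable fun n => z s n ^ 2)
    (hL : Tendsto (fun n => ∑ s, lwFlux a (z s) n) atTop (𝓝 L)) (hL0 : L ≠ 0) :
    Summable fun n => |1 / a (n + 1)| := by
  set q : ℕ → ℝ := fun n => ∑ s, |z s n * z s (n + 1)| with hq
  have hqs : Summable q :=
    summable_sum fun s _ => (hz s).mul_of_sq ((summable_nat_add_iff 1).2 (hz s))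
  have hev : ∀ᶠ n in atTop, |L| / 2 < |∑ s, lwFlux a (z s) (n + 1)| :=
    (tendsto_add_atTop_iff_nat 1).2 hL.abs |>.eventually
      (lt_mem_nhds (by linarith [abs_pos.2 hL0]))
  refine Summable.of_norm_bounded_eventually_nat (hqs.div_const (|L| / 2)) ?_
  filter_upwards [hev] with n hn
  have hL1 := abs_pos.2 hL0
  rw [Real.norm_eq_abs, abs_abs, le_div_iff₀ (by positivity), abs_div, abs_one,
    div_mul_eq_mul_div, one_mul, div_le_iff₀ (abs_pos.2 (ha _ n.succ_pos))]
  refine hn.le.trans ?_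
  simp only [lwFlux]
  rw [← Finset.mul_sum, abs_mul, mul_comm]
  exact mul_le_mul_of_nonneg_right (Finset.abs_sum_le_sum_abs _ _) (abs_nonneg _)

/-- Prescribed absolutely summable inner products of consecutive terms are realised by a square
summable sequence in the plane. -/
theorem exists_sq_summable_of_summable {b : ℕ → ℝ} (hb0 : ∀ n, b n ≠ 0)
    (hb : Summable fun n => |b n|) :
    ∃ u v : ℕ → ℝ, (Summable fun n => u n ^ 2) ∧ (Summable fun n => v n ^ 2) ∧
      ∀ n, u n * u (n + 1) + v n * v (n + 1) = b (n + 1) := by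
  -- Radii: square summable, yet `ρ n * ρ (n + 1) ≥ |b (n + 1)|`, so the required cosine `t n` lies
  -- in `[-1, 1]`.
  set ρ : ℕ → ℝ := fun n => Real.sqrt (|b n| + |b (n + 1)|) with hρ
  have hρ0 : ∀ n, 0 < ρ n := fun n =>
    Real.sqrt_pos.2 (add_pos_of_pos_of_nonneg (abs_pos.2 (hb0 n)) (abs_nonneg _))
  have hρs : Summable fun n => ρ n ^ 2 := by
    refine (hb.add ((summable_nat_add_iff 1).2 hb)).congr fun n => ?_
    exact (Real.sq_sqrt (by positivity)).symm
  set t : ℕ → ℝ := fun n => b (n + 1) / (ρ n * ρ (n + 1)) with ht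
  have ht1 : ∀ n, |t n| ≤ 1 := by
    intro n
    simp only [ht]
    rw [abs_div, abs_of_pos (mul_pos (hρ0 n) (hρ0 (n + 1))),
      div_le_one (mul_pos (hρ0 n) (hρ0 (n + 1)))]
    simp only [hρ]
    rw [← Real.sqrt_mul (by positivity)]
    refine Real.le_sqrt_of_sq_le ?_
    nlinarith [abs_nonneg (b n), abs_nonneg (b (n + 1)), abs_nonneg (b (n + 1 + 1)),
      mul_nonneg (abs_nonneg (b n)) (abs_nonneg (b (n + 1))),
      mul_nonneg (abs_nonneg (b n)) (abs_nonneg (b (n + 1 + 1))),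
      mul_nonneg (abs_nonneg (b (n + 1))) (abs_nonneg (b (n + 1 + 1)))]
  set θ : ℕ → ℝ := fun n => ∑ i ∈ Finset.range n, Real.arccos (t i) with hθ
  have hcos : ∀ n, Real.cos (θ (n + 1) - θ n) = t n := by
    intro n
    simp only [hθ, Finset.sum_range_succ, add_sub_cancel_left]
    exact Real.cos_arccos (neg_le_of_abs_le (ht1 n)) (le_of_abs_le (ht1 n))
  refine ⟨fun n => ρ n * Real.cos (θ n), fun n => ρ n * Real.sin (θ n), ?_, ?_, fun n => ?_⟩
  · refine Summable.of_nonneg_of_le (fun _ => sq_nonneg _) (fun n => ?_) hρs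
    rw [mul_pow]
    exact mul_le_of_le_one_right (sq_nonneg _) (Real.cos_sq_le_one _)
  · refine Summable.of_nonneg_of_le (fun _ => sq_nonneg _) (fun n => ?_) hρs
    rw [mul_pow]
    exact mul_le_of_le_one_right (sq_nonneg _) (Real.sin_sq_le_one _)
  · have h1 := hcos n
    rw [Real.cos_sub] at h1
    have h2 : ρ n * ρ (n + 1) * t n = b (n + 1) :=
      mul_div_cancel₀ _ (mul_pos (hρ0 n) (hρ0 (n + 1))).ne'
    rw [← h2, ← h1]
    ring

end Sequences

/-! ### The Larson–Wogen system. -/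

section LarsonWogen

open Filter Topology

variable {H : Type*} [NormedAddCommGroup H] [InnerProductSpace ℝ H]
  (e : HilbertBasis ℕ ℝ H) (a : ℕ → ℝ)

theorem HilbertBasis.inner_eq_ite (m n : ℕ) : ⟪e m, e n⟫_ℝ = if m = n then 1 else 0 :=
  orthonormal_iff_ite.1 e.orthonormal m n

theorem lwSystem_biorthogonal : IsBiorthogonal (lwSystem e a) (lwDual e a) := by
  intro m n
  have key := e.inner_eq_ite
  by_cases hn : Even n
  swap
  · by_cases hm : Even m
    · simp only [lwSystem, lwDual, if_pos hm, if_neg hn, key]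
    · have hm1 : Even (m + 1) := by simpa [Nat.even_add_one] using hm
      have hm2 : m - 1 ≠ n := fun h => by
        rw [Nat.even_iff] at hm hn
        omega
      have hm3 : m + 1 ≠ n := fun h => hn (h ▸ hm1)
      simp [lwSystem, lwDual, hm, hn, inner_add_left, inner_smul_left, key, hm2, hm3]
  obtain ⟨j, rfl⟩ := even_iff_exists_two_mul.1 hn
  have hdual : lwDual e a (2 * j) = (if j = 0 then 0 else -(a (2 * j) • e (2 * j - 1))) +
      e (2 * j) + a (2 * j + 1) • e (2 * j + 1) := by
    simp [lwDual]
  rw [hdual]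
  by_cases hm : Even m
  · have hm1 : m ≠ 2 * j + 1 := fun h => by simp [h] at hm
    have hm2 : j ≠ 0 → m ≠ 2 * j - 1 := fun h0 h => by
      rw [Nat.even_iff] at hm
      omega
    by_cases hj : j = 0
    · subst hj
      simp only [Nat.mul_zero, Nat.zero_add] at hm1
      simp [lwSystem, hm, inner_add_right, inner_smul_right, key, hm1]
    · simp [lwSystem, hm, inner_add_right, inner_smul_right, key, hm1, hm2 hj, hj]
  -- For `m` odd and `n` even, neighbouring indices give two terms that cancel by the opposite
  -- signs.
  obtain ⟨i, rfl⟩ := Nat.not_even_iff_odd.1 hm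
  have hsys : lwSystem e a (2 * i + 1) = -(a (2 * i + 1) • e (2 * i)) + e (2 * i + 1) +
      a (2 * i + 2) • e (2 * i + 2) := by
    simp only [lwSystem, if_neg hm, Nat.add_sub_cancel]
  rw [hsys, if_neg (by omega : ¬ 2 * i + 1 = 2 * j)]
  rcases j with _ | j
  · simp only [if_true, inner_add_left, inner_add_right, inner_smul_left, inner_smul_right,
      inner_neg_left, inner_zero_right, key]
    rcases i with _ | i <;> simp
  · rw [if_neg (Nat.succ_ne_zero j), show 2 * (j + 1) - 1 = 2 * j + 1 by omega]
    simp only [inner_add_left, inner_add_right, inner_smul_left, inner_smul_right,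
      inner_neg_left, inner_neg_right, key]
    by_cases hij : i = j
    · subst hij
      simp [mul_add]
      omega
    by_cases hij' : i = j + 1
    · subst hij'
      simp [mul_add]
    repeat rw [if_neg (by omega)]
    simp

/-- One factor is the single coordinate `z n`; the other is `w n` plus neighbouring terms, which
again involve only `z`. Swapping `x` and `y` by parity makes both cases agree. -/
theorem inner_lwDual_mul_inner_lwSystem (x y : H) (n : ℕ) :
    ⟪x, lwDual e a n⟫_ℝ * ⟪lwSystem e a n, y⟫_ℝ =
      (if Even n then ⟪e n, y⟫_ℝ else ⟪e n, x⟫_ℝ) * (if Even n then ⟪e n, x⟫_ℝ else ⟪e n, y⟫_ℝ) -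
      (lwFlux a (fun n => if Even n then ⟪e n, y⟫_ℝ else ⟪e n, x⟫_ℝ) n -
        lwFlux a (fun n => if Even n then ⟪e n, y⟫_ℝ else ⟪e n, x⟫_ℝ) (n + 1)) := by
  by_cases hn : Even n
  · have hn1 : ¬ Even (n + 1) := by simpa [Nat.even_add_one] using hn
    rcases n with _ | n
    · simp [lwDual, lwSystem, lwFlux, inner_add_right, inner_smul_right, real_inner_comm]
      ring
    · have hn0 : ¬ Even n := by simpa [Nat.even_add_one] using hn
      simp only [lwDual, lwSystem, lwFlux, if_pos hn, if_neg hn1, if_neg hn0, Nat.add_sub_cancel,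
        if_neg n.succ_ne_zero, inner_add_right, inner_smul_right, inner_neg_right,
        real_inner_comm x]
      ring
  · have hn1 : Even (n + 1) := by simpa [Nat.even_add_one] using hn
    rcases n with _ | n
    · simp at hn
    · have hn0 : Even n := by simpa [Nat.even_add_one] using hn
      simp only [lwDual, lwSystem, lwFlux, if_neg hn, if_pos hn1, if_pos hn0, Nat.add_sub_cancel,
        inner_add_left, inner_smul_left, inner_neg_left, real_inner_comm x]
      simp
      ring

theorem isCompleteSystem_of_basis_mem {f : ℕ → H} (h : ∀ n, e n ∈ Submodule.span ℝ (Set.range f)) :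
    IsCompleteSystem f := by
  have hle : Submodule.span ℝ (Set.range e) ≤ Submodule.span ℝ (Set.range f) := by
    rw [Submodule.span_le]
    rintro _ ⟨n, rfl⟩
    exact h n
  rw [IsCompleteSystem, eq_top_iff, ← e.dense_span]
  exact Submodule.topologicalClosure_mono hle

theorem lwSystem_complete : IsCompleteSystem (lwSystem e a) := by
  have heven : ∀ n, Even n → e n ∈ Submodule.span ℝ (Set.range (lwSystem e a)) := fun n hn =>
    Submodule.subset_span ⟨n, by simp [lwSystem, hn]⟩
  refine isCompleteSystem_of_basis_mem e fun n => ?_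
  by_cases hn : Even n
  · exact heven n hn
  obtain ⟨j, rfl⟩ := Nat.not_even_iff_odd.1 hn
  have h : e (2 * j + 1) = lwSystem e a (2 * j + 1) + a (2 * j + 1) • e (2 * j)
      - a (2 * j + 2) • e (2 * j + 2) := by
    simp only [lwSystem, if_neg hn, Nat.add_sub_cancel]
    abel
  rw [h]
  exact sub_mem (add_mem (Submodule.subset_span ⟨_, rfl⟩)
    (Submodule.smul_mem _ _ (heven _ (by simp))))
    (Submodule.smul_mem _ _ (heven _ (by simp [Nat.even_add])))

theorem lwDual_complete : IsCompleteSystem (lwDual e a) := by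
  have hodd : ∀ n, ¬ Even n → e n ∈ Submodule.span ℝ (Set.range (lwDual e a)) := fun n hn =>
    Submodule.subset_span ⟨n, by simp [lwDual, hn]⟩
  refine isCompleteSystem_of_basis_mem e fun n => ?_
  by_cases hn : Even n
  swap
  · exact hodd n hn
  have hn1 : ¬ Even (n + 1) := by simpa [Nat.even_add_one] using hn
  have hprev : (if n = 0 then 0 else -(a n • e (n - 1))) ∈
      Submodule.span ℝ (Set.range (lwDual e a)) := by
    split_ifs with h0
    · exact zero_mem _
    · refine neg_mem (Submodule.smul_mem _ _ (hodd _ fun h => hn1 ?_))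
      rwa [show n + 1 = n - 1 + 2 by omega, Nat.even_add, iff_true_right (by decide)]
  have h : e n = lwDual e a n - (if n = 0 then 0 else -(a n • e (n - 1)))
      - a (n + 1) • e (n + 1) := by
    simp only [lwDual, if_pos hn]
    abel
  rw [h]
  exact sub_mem (sub_mem (Submodule.subset_span ⟨_, rfl⟩) hprev)
    (Submodule.smul_mem _ _ (hodd _ hn1))

theorem HilbertBasis.summable_inner_sq (x : H) : Summable fun n => ⟪e n, x⟫_ℝ ^ 2 := by
  refine (e.summable_inner_mul_inner x x).congr fun n => ?_
  rw [real_inner_comm, sq]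

theorem HilbertBasis.exists_inner_eq {u : ℕ → ℝ} (hu : Summable fun n => u n ^ 2) :
    ∃ x : H, ∀ n, ⟪e n, x⟫_ℝ = u n := by
  refine ⟨e.repr.symm ⟨u, memℓp_two_iff.2 hu⟩, fun n => ?_⟩
  rw [← e.repr_apply_apply, LinearIsometryEquiv.apply_symm_apply]

theorem summable_ite_sq (p : ℕ → Prop) [DecidablePred p] {u v : ℕ → ℝ}
    (hu : Summable fun n => u n ^ 2) (hv : Summable fun n => v n ^ 2) :
    Summable fun n => (if p n then u n else v n) ^ 2 := by
  refine Summable.of_nonneg_of_le (fun _ => sq_nonneg _) (fun n => ?_) (hu.add hv)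
  have := sq_nonneg (u n)
  have := sq_nonneg (v n)
  split_ifs <;> linarith

variable {a} in
theorem tendsto_flux {k : ℕ} {z w : Fin k → ℕ → ℝ} {S : ℝ}
    (hS : HasSum (fun n => ∑ s, z s n * w s n) S)
    (h : ∀ n, ∑ s, z s n * w s n = ∑ s, lwFlux a (z s) n - ∑ s, lwFlux a (z s) (n + 1)) :
    Tendsto (fun n => ∑ s, lwFlux a (z s) n) atTop (𝓝 (-S)) := by
  -- Partial sums telescope to minus the flux at `N`, as the flux vanishes at `0`.
  refine hS.tendsto_sum_nat.neg.congr fun N => ?_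
  simp only [h]
  rw [Finset.sum_range_sub']
  simp [lwFlux]

variable {a} in
theorem exists_tendsto_flux {k : ℕ} {z w : Fin k → ℕ → ℝ}
    (hz : ∀ s, Summable fun n => z s n ^ 2) (hw : ∀ s, Summable fun n => w s n ^ 2)
    (h : ∀ n, ∑ s, z s n * w s n = ∑ s, lwFlux a (z s) n - ∑ s, lwFlux a (z s) (n + 1)) :
    ∃ L, Tendsto (fun n => ∑ s, lwFlux a (z s) n) atTop (𝓝 L) :=
  ⟨_, tendsto_flux
    (summable_sum fun s _ => ((hz s).mul_of_sq (hw s)).of_abs).hasSum h⟩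

/-- The trace condition for the Larson–Wogen system in coordinates. -/
theorem annihilatorTraceZero_lw_iff (k : ℕ) :
    AnnihilatorTraceZero (lwSystem e a) (lwDual e a) k ↔
      ∀ z w : Fin k → ℕ → ℝ, (∀ s, Summable fun n => z s n ^ 2) →
        (∀ s, Summable fun n => w s n ^ 2) →
        (∀ n, ∑ s, z s n * w s n = ∑ s, lwFlux a (z s) n - ∑ s, lwFlux a (z s) (n + 1)) →
        Tendsto (fun n => ∑ s, lwFlux a (z s) n) atTop (𝓝 0) := by
  have hsum : ∀ x y : Fin k → H, HasSum (fun n => ∑ s,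
      (if Even n then ⟪e n, y s⟫_ℝ else ⟪e n, x s⟫_ℝ) *
        (if Even n then ⟪e n, x s⟫_ℝ else ⟪e n, y s⟫_ℝ)) (∑ s, ⟪x s, y s⟫_ℝ) := by
    intro x y
    refine hasSum_sum fun s _ => ?_
    convert! e.hasSum_inner_mul_inner (x s) (y s) using 1
    funext n
    rw [real_inner_comm (e n) (x s)]
    split_ifs
    · exact mul_comm _ _
    · rfl
  have hcond : ∀ (x y : Fin k → H) (n : ℕ),
      ∑ s, ⟪x s, lwDual e a n⟫_ℝ * ⟪lwSystem e a n, y s⟫_ℝ = 0 ↔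
      ∑ s, (if Even n then ⟪e n, y s⟫_ℝ else ⟪e n, x s⟫_ℝ) *
        (if Even n then ⟪e n, x s⟫_ℝ else ⟪e n, y s⟫_ℝ) =
      ∑ s, lwFlux a (fun n => if Even n then ⟪e n, y s⟫_ℝ else ⟪e n, x s⟫_ℝ) n -
        ∑ s, lwFlux a (fun n => if Even n then ⟪e n, y s⟫_ℝ else ⟪e n, x s⟫_ℝ) (n + 1) := by
    intro x y n
    simp only [inner_lwDual_mul_inner_lwSystem, Finset.sum_sub_distrib]
    exact sub_eq_zero
  constructor
  · intro hd z w hz hw h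
    choose x hx using fun s => e.exists_inner_eq (summable_ite_sq Even (hw s) (hz s))
    choose y hy using fun s => e.exists_inner_eq (summable_ite_sq Even (hz s) (hw s))
    have hzz : ∀ s n, (if Even n then ⟪e n, y s⟫_ℝ else ⟪e n, x s⟫_ℝ) = z s n := by
      intro s n
      rw [hx, hy]
      split_ifs <;> rfl
    have hww : ∀ s n, (if Even n then ⟪e n, x s⟫_ℝ else ⟪e n, y s⟫_ℝ) = w s n := by
      intro s n
      rw [hx, hy]
      split_ifs <;> rfl
    have h1 := hd x y fun n => (hcond x y n).2 (by simpa only [hzz, hww] using h n)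
    have h2 := hsum x y
    simp only [hzz, hww, h1] at h2
    simpa using tendsto_flux h2 h
  · intro hd x y hxy
    have hc := fun n => (hcond x y n).1 (hxy n)
    have h1 := tendsto_flux (hsum x y) hc
    have h2 := hd _ _
      (fun s => summable_ite_sq Even (e.summable_inner_sq (y s)) (e.summable_inner_sq (x s)))
      (fun s => summable_ite_sq Even (e.summable_inner_sq (x s)) (e.summable_inner_sq (y s))) hc
    exact neg_eq_zero.1 (tendsto_nhds_unique h1 h2)

variable {a}

theorem not_annihilatorTraceZero_lw (ha : ∀ n : ℕ, 0 < n → a n ≠ 0) {k : ℕ}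
    {z : Fin k → ℕ → ℝ} (hz : ∀ s, Summable fun n => z s n ^ 2)
    (h : ∀ n, ∑ s, z s n * z s (n + 1) = 1 / a (n + 1)) :
    ¬ AnnihilatorTraceZero (lwSystem e a) (lwDual e a) k := by
  rw [annihilatorTraceZero_lw_iff]
  intro hd
  have hflux : ∀ n, ∑ s, lwFlux a (z s) (n + 1) = 1 := by
    intro n
    simp only [lwFlux]
    rw [← Finset.mul_sum, h, mul_one_div_cancel (ha _ n.succ_pos)]
  have hQ : ∑ s, z s 0 * z s 0 ≠ 0 := by
    intro hQ
    have h0 := (Finset.sum_eq_zero_iff_of_nonneg fun s _ => mul_self_nonneg (z s 0)).1 hQ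
    have h1 := h 0
    rw [Finset.sum_eq_zero fun s hs => by rw [mul_self_eq_zero.1 (h0 s hs), zero_mul]] at h1
    exact one_div_ne_zero (ha 1 one_pos) h1.symm
  -- The flux is `0` at index `0` and `1` afterwards, so `w` need only create the jump `-1` at index
  -- `0`.
  have h0 := hd z (fun s n => if n = 0 then -(z s 0 / ∑ s, z s 0 * z s 0) else 0) hz
    (fun s => summable_of_ne_finset_zero (s := {0}) fun n hn => by
      rw [if_neg (by simpa using hn)]; simp) fun n => by
    rcases n with _ | n
    · rw [hflux]
      simp only [if_true, lwFlux, Finset.sum_const_zero, mul_neg, Finset.sum_neg_distrib,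
        ← mul_div_assoc, ← Finset.sum_div, div_self hQ, zero_sub]
    · rw [hflux, hflux]
      simp
  have h1 := (tendsto_add_atTop_iff_nat 1).2 h0
  simp only [hflux] at h1
  exact one_ne_zero (tendsto_nhds_unique tendsto_const_nhds h1)

theorem annihilatorTraceZero_lw_one_iff (ha : ∀ n : ℕ, 0 < n → a n ≠ 0) :
    AnnihilatorTraceZero (lwSystem e a) (lwDual e a) 1 ↔
      ¬ Memℓp (fun n : ℕ => lwMu a (n + 1)) 2 := by
  rw [memℓp_two_iff, summable_nat_add_iff 1 (f := fun n => lwMu a n ^ 2)]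
  constructor
  · intro hd hs
    refine not_annihilatorTraceZero_lw e ha (z := fun _ => lwMu a) (fun _ => hs) (fun n => ?_) hd
    simpa using lwMu_mul_lwMu_succ ha n
  · intro hs
    rw [annihilatorTraceZero_lw_iff]
    intro z w hz hw h
    obtain ⟨L, hL⟩ := exists_tendsto_flux hz hw h
    by_cases hL0 : L = 0
    · rwa [hL0] at hL
    · refine absurd (summable_lwMu_sq ha (hz 0) (hw 0) (fun n => ?_) ?_ hL0) hs
      · simpa using h n
      · simpa using hL

theorem annihilatorTraceZero_lw_iff_of_one_lt (ha : ∀ n : ℕ, 0 < n → a n ≠ 0) {k : ℕ}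
    (hk : 1 < k) : AnnihilatorTraceZero (lwSystem e a) (lwDual e a) k ↔
      ¬ Memℓp (fun n : ℕ => 1 / a (n + 1)) 1 := by
  rw [memℓp_one_iff]
  constructor
  · intro hd hs
    obtain ⟨k, rfl⟩ := Nat.exists_eq_add_of_le' hk
    obtain ⟨u, v, hu, hv, huv⟩ := exists_sq_summable_of_summable
      -- `b 0` is an arbitrary nonzero filler: `a 0` is unconstrained.
      (b := fun n => if n = 0 then 1 else 1 / a n)
      (fun n => by
        split_ifs with h0
        · exact one_ne_zero
        · exact one_div_ne_zero (ha n (Nat.pos_of_ne_zero h0)))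
      ((summable_nat_add_iff 1).1 (by simpa using hs))
    refine not_annihilatorTraceZero_lw e ha (z := Fin.cons u (Fin.cons v fun _ _ => 0))
      (fun s => ?_) (fun n => ?_) hd
    · refine Fin.cases hu (fun s => ?_) s
      refine Fin.cases hv (fun s => ?_) s
      simp
    · simpa [Fin.sum_univ_succ] using huv n
  · intro hs
    rw [annihilatorTraceZero_lw_iff]
    intro z w hz hw h
    obtain ⟨L, hL⟩ := exists_tendsto_flux hz hw h
    by_cases hL0 : L = 0
    · rwa [hL0] at hL
    · exact absurd (summable_inv_of_tendsto_flux ha hz hL hL0) hs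

end LarsonWogen

theorem theorem3p1 {H : Type*} [NormedAddCommGroup H] [InnerProductSpace ℝ H] [CompleteSpace H]
    (e : HilbertBasis ℕ ℝ H) (a : ℕ → ℝ) (ha : ∀ n : ℕ, 0 < n → a n ≠ 0) :
    IsBiorthogonal (lwSystem e a) (lwDual e a) ∧
    IsCompleteSystem (lwSystem e a) ∧
    IsCompleteSystem (lwDual e a) ∧
    IsMBasis (lwSystem e a) ∧
    (IsKPointDense (lwSystem e a) 1 ↔ ¬ Memℓp (fun n : ℕ => lwMu a (n + 1)) 2) ∧
    (IsStrongMBasis (lwSystem e a) ↔ ¬ Memℓp (fun n : ℕ => lwMu a (n + 1)) 2) ∧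
    (∀ k : ℕ, 1 < k →
      (IsKPointDense (lwSystem e a) k ↔ ¬ Memℓp (fun n : ℕ => 1 / a (n + 1)) 1)) := by
  have hb := lwSystem_biorthogonal e a
  have hf := lwSystem_complete e a
  have hg := lwDual_complete e a
  refine ⟨hb, hf, hg, ⟨hb.isMinimalSystem, hf, _, hb, hg⟩, ?_, ?_, fun k hk => ?_⟩
  · rw [isKPointDense_iff hf hb, annihilatorTraceZero_lw_one_iff e ha]
  · rw [isStrongMBasis_iff hf hg hb, annihilatorTraceZero_lw_one_iff e ha]
  · rw [isKPointDense_iff hf hb, annihilatorTraceZero_lw_iff_of_one_lt e ha hk]
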